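/- Let $n\ge 1$ and let $M$ be a paracompact (Hausdorff) $C^\infty$ manifold of dimension $2n$; all objects below are of class $C^\infty$. Brackets are Frölicher–Nijenhuis brackets: for vector fields $X,Y$ and vector $1$-forms (fields of endomorphisms of $TM$) $K,N$, $[X,K]Y=[X,KY]-K[X,Y]$, $[K,X]=-[X,K]$, and $$[K,N](X,Y)=[KX,NY]+[NX,KY]+KN[X,Y]+NK[X,Y]-K[NX,Y]-K[X,NY]-N[KX,Y]-N[X,KY].$$ Let $L$ be a vector $1$-form on $M$ with $[L,L]=0$ and $\operatorname{Im}(L_z)=\operatorname{Ker}(L_z)$ for every $z\in M$ (so $L$ has constant rank $n$), and let $C$ be a vector field on $M$ (the canonical vector field) such that every point of $M$ lies in the domain of a chart $(x^1,\dots,x^n,y^1,\dots,y^n)$ in which $$L\frac{\partial}{\partial x^i}=\frac{\partial}{\partial y^i},\qquad L\frac{\partial}{\partial y^i}=0,\qquad C=\sum_i y^i\frac{\partial}{\partial y^i}.$$ An $L$-connection is a vector $1$-form $\Gamma$ on $M$ with $L\Gamma=L$ and $\Gamma L=-L$; it is homogeneous if $[C,\Gamma]=0$. An $L$-spray is a vector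 field $G$ on $M$ with $LG=C$ and $[C,G]=G$. A homogeneous $L$-connection $\Gamma$ is conservative if $\Gamma=[L,G]$ for some $L$-spray $G$. The torsion of $\Gamma$ is $T=\frac12[L,\Gamma]$. Theorem 4. A homogeneous $L$-connection $\Gamma$ on $M$ is conservative if and only if $[L,\Gamma]=0$, i.e. if and only if its torsion $T$ vanishes. -/

import Mathlib

open scoped Manifold ContDiff

noncomputable section

/-- Smooth vector fields on a `2n`-dimensional manifold `M` (charts with values in `ℝⁿ⁺ⁿ`). -/
abbrev VField (n : ℕ) (M : Type*) [TopologicalSpace M]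
    [ChartedSpace (EuclideanSpace ℝ (Fin (n + n))) M] [IsManifold (𝓡 (n + n)) ∞ M] : Type _ :=
  ContMDiffSection (𝓡 (n + n)) (EuclideanSpace ℝ (Fin (n + n))) ∞
    (fun z : M => TangentSpace (𝓡 (n + n)) z)

/-- Smooth vector `1`-forms on `M`, i.e. smooth sections `z ↦ (K z : T_z M → T_z M)` of the bundle
of endomorphisms of the tangent bundle. -/
abbrev VForm (n : ℕ) (M : Type*) [TopologicalSpace M]
    [ChartedSpace (EuclideanSpace ℝ (Fin (n + n))) M] [IsManifold (𝓡 (n + n)) ∞ M] : Type _ :=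
  ContMDiffSection (𝓡 (n + n))
    (EuclideanSpace ℝ (Fin (n + n)) →L[ℝ] EuclideanSpace ℝ (Fin (n + n))) ∞
    (fun z : M => TangentSpace (𝓡 (n + n)) z →L[ℝ] TangentSpace (𝓡 (n + n)) z)

section

variable {n : ℕ} {M : Type*} [TopologicalSpace M]
  [ChartedSpace (EuclideanSpace ℝ (Fin (n + n))) M] [IsManifold (𝓡 (n + n)) ∞ M]

/-- The vector field `K X : z ↦ K_z (X_z)`. -/
def VForm.app (K : VForm n M) (X : VField n M) : VField n M where
  toFun z := K z (X z)
  contMDiff_toFun := ContMDiff.clm_bundle_apply K.contMDiff X.contMDiff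

/-- The Lie bracket `[X, Y]` of two vector fields. -/
def lieBr (X Y : VField n M) : VField n M where
  toFun z := VectorField.mlieBracket (𝓡 (n + n)) (fun w => X w) (fun w => Y w) z
  contMDiff_toFun := by
    have : IsManifold (𝓡 (n + n)) (((⊤ : ℕ∞) : ℕ∞ω) + 1) M := by
      simpa using (inferInstance : IsManifold (𝓡 (n + n)) ∞ M)
    have : IsManifold (𝓡 (n + n)) (minSmoothness ℝ 2) M := by
      simpa using IsManifold.of_le (I := 𝓡 (n + n)) (M := M) (m := 2) (n := ∞)
        (by norm_cast)
    exact ContDiff.mlieBracket_vectorField (m := ⊤) (n := ⊤) X.contMDiff Y.contMDiff (by simp)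

/-- The Frölicher–Nijenhuis bracket `[X, K]` of a vector field and a vector `1`-form (the Lie
derivative of `K` along `X`), as a map of vector fields: `[X, K] Y = [X, K Y] - K [X, Y]`. -/
def fnFieldForm (X : VField n M) (K : VForm n M) (Y : VField n M) : VField n M :=
  lieBr X (K.app Y) - K.app (lieBr X Y)

/-- The Frölicher–Nijenhuis bracket `[K, X] = -[X, K]` of a vector `1`-form and a vector field, as
a map of vector fields: `[K, X] Y = [K Y, X] - K [Y, X]`. -/
def fnFormField (K : VForm n M) (X : VField n M) (Y : VField n M) : VField n M :=
  lieBr (K.app Y) X - K.app (lieBr Y X)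

/-- The Frölicher–Nijenhuis bracket `[K, N]` of two vector `1`-forms, a vector `2`-form, given by
its values on vector fields. -/
def fnFormForm (K N : VForm n M) (X Y : VField n M) : VField n M :=
  lieBr (K.app X) (N.app Y) + lieBr (N.app X) (K.app Y)
    + K.app (N.app (lieBr X Y)) + N.app (K.app (lieBr X Y))
    - K.app (lieBr (N.app X) Y) - K.app (lieBr X (N.app Y))
    - N.app (lieBr (K.app X) Y) - N.app (lieBr X (K.app Y))

/-- `dcoord e w v k` is the `k`-th component, in the chart `e`, of the tangent vector `v` at `w`.
The coordinates are `(x¹, …, xⁿ, y¹, …, yⁿ)`: the index `Fin.castAdd n i` belongs to `xⁱ` and the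
index `Fin.natAdd n i` to `yⁱ`. -/
def dcoord (e : OpenPartialHomeomorph M (EuclideanSpace ℝ (Fin (n + n)))) (w : M)
    (v : TangentSpace (𝓡 (n + n)) w) (k : Fin (n + n)) : ℝ :=
  let u : EuclideanSpace ℝ (Fin (n + n)) := mfderiv (𝓡 (n + n)) (𝓡 (n + n)) e w v
  u k

/-- A smooth chart `e = (x, y)` is natural for `(L, C)` if on its domain
`L (∂/∂xⁱ) = ∂/∂yⁱ`, `L (∂/∂yⁱ) = 0` (that is, `L (Xⁱ ∂/∂xⁱ + Yⁱ ∂/∂yⁱ) = Xⁱ ∂/∂yⁱ`) and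
`C = yⁱ ∂/∂yⁱ`. -/
structure IsNaturalChart (L : VForm n M) (C : VField n M)
    (e : OpenPartialHomeomorph M (EuclideanSpace ℝ (Fin (n + n)))) : Prop where
  mem_atlas : e ∈ IsManifold.maximalAtlas (𝓡 (n + n)) ∞ M
  L_x : ∀ w ∈ e.source, ∀ (v : TangentSpace (𝓡 (n + n)) w) (i : Fin n),
    dcoord e w (L w v) (Fin.castAdd n i) = 0
  L_y : ∀ w ∈ e.source, ∀ (v : TangentSpace (𝓡 (n + n)) w) (i : Fin n),
    dcoord e w (L w v) (Fin.natAdd n i) = dcoord e w v (Fin.castAdd n i)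
  C_x : ∀ w ∈ e.source, ∀ i : Fin n, dcoord e w (C w) (Fin.castAdd n i) = 0
  C_y : ∀ w ∈ e.source, ∀ i : Fin n, dcoord e w (C w) (Fin.natAdd n i) = e w (Fin.natAdd n i)

/-- `L` is an integrable almost-tangent structure on `M` with canonical vector field `C`. -/
structure IsLStructure (L : VForm n M) (C : VField n M) : Prop where
  nijenhuis : ∀ X Y : VField n M, fnFormForm L L X Y = 0
  range_eq_ker : ∀ z : M, LinearMap.range (L z).toLinearMap = LinearMap.ker (L z).toLinearMap
  natural_chart : ∀ z : M, ∃ e : OpenPartialHomeomorph M (EuclideanSpace ℝ (Fin (n + n))),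
    z ∈ e.source ∧ IsNaturalChart L C e

/-- `L`-connections: `L Γ = L` and `Γ L = -L`. -/
structure IsLConnection (L Γ : VForm n M) : Prop where
  left : ∀ z : M, (L z).comp (Γ z) = L z
  right : ∀ z : M, (Γ z).comp (L z) = -L z

/-- A vector `1`-form is homogeneous of degree one: `[C, Γ] = 0`. -/
def IsHomogeneousOne (C : VField n M) (Γ : VForm n M) : Prop :=
  ∀ X : VField n M, fnFieldForm C Γ X = 0

/-- `L`-semisprays: `L S = C`. -/
def IsLSemispray (L : VForm n M) (C S : VField n M) : Prop := L.app S = C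

/-- `L`-sprays: semisprays that are homogeneous of degree two, `[C, S] = S`. -/
def IsLSpray (L : VForm n M) (C S : VField n M) : Prop :=
  IsLSemispray L C S ∧ lieBr C S = S

/-- `Γ` is conservative: `Γ = [L, G]` for some `L`-spray `G`. -/
def IsConservative (L : VForm n M) (C : VField n M) (Γ : VForm n M) : Prop :=
  ∃ G : VField n M, IsLSpray L C G ∧ ∀ X : VField n M, Γ.app X = fnFormField L G X

/-- The torsion `T = ½ [L, Γ]` of `Γ`. -/
def torsion (L Γ : VForm n M) (X Y : VField n M) : VField n M :=
  (1 / 2 : ℝ) • fnFormForm L Γ X Y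

end

end

/-
Taking the Lie derivative along a vector field `G` is a derivation of the Frölicher–Nijenhuis
bracket. Hence `[L, L] = 0` gives `2 [L, [L, G]] = 0`, and conservative connections have no torsion.

Conversely, `Γ = -1` on `Ker L = Im L`, so `L` is injective on the `1`-eigenspaces of `Γ`, and `C`
has a unique lift `G` with `L G = C` and `Γ G = G`. Uniqueness makes the local smooth lifts agree,
so `G` is smooth without a partition of unity. Homogeneity of `Γ` shows that `[C, G]` is another
such lift, so `G` is a spray. Finally `L [V, G] = V` for every vertical `V`; inserting `V = L X` and
`V = Γ X - X` in the definition of the torsion gives `T(X, G) = [L, G] X - Γ X`, so `T = 0` forces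
`Γ = [L, G]`.
-/

section LieRing

variable {A : Type*} [LieRing A]

/-- The Frölicher–Nijenhuis bracket `[K, G]` of an endomorphism and an element of a Lie ring, the
algebraic model of `fnFormField`. -/
def endoElemBracket (K : A → A) (G X : A) : A := ⁅K X, G⁆ - K ⁅X, G⁆

/-- The Frölicher–Nijenhuis bracket `[K, N]` of two endomorphisms of a Lie ring, the algebraic
model of `fnFormForm`. -/
def endoEndoBracket (K N : A → A) (X Y : A) : A :=
  ⁅K X, N Y⁆ + ⁅N X, K Y⁆ + K (N ⁅X, Y⁆) + N (K ⁅X, Y⁆)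
    - K ⁅N X, Y⁆ - K ⁅X, N Y⁆ - N ⁅K X, Y⁆ - N ⁅X, K Y⁆

theorem endoEndoBracket_comm (K N : A → A) (X Y : A) :
    endoEndoBracket K N X Y = endoEndoBracket N K X Y := by
  simp only [endoEndoBracket]
  abel

theorem endoEndoBracket_endoElemBracket_add (K N : A →+ A) (G X Y : A) :
    endoEndoBracket K (endoElemBracket N G) X Y + endoEndoBracket (endoElemBracket K G) N X Y =
      ⁅endoEndoBracket K N X Y, G⁆ - endoEndoBracket K N ⁅X, G⁆ Y
        - endoEndoBracket K N X ⁅Y, G⁆ := by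
  have leibniz (a b : A) : ⁅⁅a, b⁆, G⁆ = ⁅⁅a, G⁆, b⁆ + ⁅a, ⁅b, G⁆⁆ := by
    rw [lie_lie, ← lie_skew ⁅a, G⁆ b]
    abel
  simp only [endoEndoBracket, endoElemBracket, add_lie, sub_lie, lie_sub, map_add, map_sub,
    leibniz]
  abel

theorem endoEndoBracket_endoElemBracket_eq_zero [IsAddTorsionFree A] {L : A →+ A}
    (hL : ∀ X Y, endoEndoBracket L L X Y = 0) (G X Y : A) :
    endoEndoBracket L (endoElemBracket L G) X Y = 0 := by
  have h := endoEndoBracket_endoElemBracket_add L L G X Y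
  rw [endoEndoBracket_comm (endoElemBracket L G) L] at h
  simp only [hL, zero_lie, sub_zero] at h
  rw [← two_nsmul] at h
  exact (nsmul_eq_zero_iff_right two_ne_zero).1 h

end LieRing

section Chart

variable {𝕜 E E' H H' M M' : Type*} [NontriviallyNormedField 𝕜]
  [NormedAddCommGroup E] [NormedSpace 𝕜 E] [TopologicalSpace H] {I : ModelWithCorners 𝕜 E H}
  [TopologicalSpace M] [ChartedSpace H M]
  [NormedAddCommGroup E'] [NormedSpace 𝕜 E'] [TopologicalSpace H'] {I' : ModelWithCorners 𝕜 E' H'}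
  [TopologicalSpace M'] [ChartedSpace H' M']

theorem mdifferentiable_of_mem_maximalAtlas {n : ℕ∞ω} (hn : n ≠ 0)
    {e : OpenPartialHomeomorph M H} (he : e ∈ IsManifold.maximalAtlas I n M) :
    e.MDifferentiable I I :=
  ⟨fun _ hz => ((contMDiffAt_of_mem_maximalAtlas he hz).mdifferentiableAt hn)
      |>.mdifferentiableWithinAt,
    fun _ hp => ((contMDiffAt_symm_of_mem_maximalAtlas he hp).mdifferentiableAt hn)
      |>.mdifferentiableWithinAt⟩

variable {e : OpenPartialHomeomorph M M'}

theorem isInvertible_mfderiv_of_mdifferentiable (he : e.MDifferentiable I I') {z : M}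
    (hz : z ∈ e.source) : (mfderiv I I' e z).IsInvertible :=
  ⟨he.mfderiv hz, rfl⟩

theorem mpullback_symm_apply_of_mdifferentiable (he : e.MDifferentiable I I')
    (X : ∀ z : M, TangentSpace I z) {z : M} (hz : z ∈ e.source) :
    VectorField.mpullback I' I e.symm X (e z) = mfderiv I I' e z (X z) := by
  have hsymm := he.symm_comp_deriv (e.map_target (e.map_source hz))
  rw [e.right_inv (e.map_source hz)] at hsymm
  have hinv : (mfderiv I' I e.symm (e z)).inverse = mfderiv I I' e (e.symm (e z)) :=
    ContinuousLinearMap.inverse_eq hsymm (he.comp_symm_deriv (e.map_source hz))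
  rw [VectorField.mpullback_apply, hinv, e.left_inv hz]

end Chart

section LieBracket

variable {𝕜 E F : Type*} [NontriviallyNormedField 𝕜] [NormedAddCommGroup E] [NormedSpace 𝕜 E]
  [NormedAddCommGroup F] [NormedSpace 𝕜 F]

theorem clm_apply_lieBracket (f : E →L[𝕜] F) {V W : E → E} {p : E}
    (hV : DifferentiableAt 𝕜 V p) (hW : DifferentiableAt 𝕜 W p) :
    f (VectorField.lieBracket 𝕜 V W p) =
      fderiv 𝕜 (fun q => f (W q)) p (V p) - fderiv 𝕜 (fun q => f (V q)) p (W p) := by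
  have fderiv_comp {U : E → E} (hU : DifferentiableAt 𝕜 U p) (v : E) :
      fderiv 𝕜 (fun q => f (U q)) p v = f (fderiv 𝕜 U p v) :=
    DFunLike.congr_fun (f.hasFDerivAt.comp p hU.hasFDerivAt).fderiv v
  rw [VectorField.lieBracket, map_sub, fderiv_comp hV, fderiv_comp hW]

end LieBracket

section LocalToGlobal

variable {𝕜 E H M F : Type*} [NontriviallyNormedField 𝕜] [NormedAddCommGroup E]
  [NormedSpace 𝕜 E] [TopologicalSpace H] {I : ModelWithCorners 𝕜 E H} [TopologicalSpace M]
  [ChartedSpace H M] [NormedAddCommGroup F] [NormedSpace 𝕜 F] {V : M → Type*}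
  [TopologicalSpace (Bundle.TotalSpace F V)] [∀ z, TopologicalSpace (V z)] [FiberBundle F V]
  {n : ℕ∞ω}

theorem exists_contMDiffSection_of_local_of_unique {P : ∀ z, V z → Prop}
    (hunique : ∀ z v w, P z v → P z w → v = w)
    (hlocal : ∀ z, ∃ s : ∀ w, V w,
      ContMDiffAt I (I.prod 𝓘(𝕜, F)) n (fun w => Bundle.TotalSpace.mk' F w (s w)) z ∧
        ∀ᶠ w in nhds z, P w (s w)) :
    ∃ S : ContMDiffSection I F n V, ∀ z, P z (S z) := by
  have hex (z : M) : ∃ v, P z v := by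
    obtain ⟨s, -, hs⟩ := hlocal z
    exact ⟨s z, hs.self_of_nhds⟩
  choose S hS using hex
  refine ⟨⟨S, fun z => ?_⟩, hS⟩
  obtain ⟨s, hs, hPs⟩ := hlocal z
  refine hs.congr_of_eventuallyEq ?_
  filter_upwards [hPs] with w hw
  rw [hunique w _ _ (hS w) hw]

end LocalToGlobal

section

variable {n : ℕ} {M : Type*} [TopologicalSpace M]
  [ChartedSpace (EuclideanSpace ℝ (Fin (n + n))) M]
  {e : OpenPartialHomeomorph M (EuclideanSpace ℝ (Fin (n + n)))}

theorem eq_of_dcoord_eq (he : e ∈ IsManifold.maximalAtlas (𝓡 (n + n)) ∞ M) {z : M}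
    (hz : z ∈ e.source) {v w : TangentSpace (𝓡 (n + n)) z}
    (h : ∀ k, dcoord e z v k = dcoord e z w k) : v = w :=
  (mdifferentiable_of_mem_maximalAtlas (by simp) he).mfderiv_injective hz (PiLp.ext h)

/-- The representative of a vector field on `M` in the chart `e`, as a vector field on `ℝⁿ⁺ⁿ`.
Outside `e.target` its values are junk. -/
noncomputable def chartField (e : OpenPartialHomeomorph M (EuclideanSpace ℝ (Fin (n + n))))
    (X : ∀ z : M, TangentSpace (𝓡 (n + n)) z) :
    EuclideanSpace ℝ (Fin (n + n)) → EuclideanSpace ℝ (Fin (n + n)) :=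
  VectorField.mpullback (𝓡 (n + n)) (𝓡 (n + n)) e.symm X

theorem chartField_apply (he : e ∈ IsManifold.maximalAtlas (𝓡 (n + n)) ∞ M)
    (X : ∀ z : M, TangentSpace (𝓡 (n + n)) z) {z : M} (hz : z ∈ e.source) (k : Fin (n + n)) :
    chartField e X (e z) k = dcoord e z (X z) k :=
  congrArg (fun v : EuclideanSpace ℝ (Fin (n + n)) => v k)
    (mpullback_symm_apply_of_mdifferentiable
      (mdifferentiable_of_mem_maximalAtlas (by simp) he) X hz)

theorem chartField_eventuallyEq (he : e ∈ IsManifold.maximalAtlas (𝓡 (n + n)) ∞ M)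
    {X : ∀ z : M, TangentSpace (𝓡 (n + n)) z} {k : Fin (n + n)}
    {f : EuclideanSpace ℝ (Fin (n + n)) → ℝ} (h : ∀ w ∈ e.source, dcoord e w (X w) k = f (e w))
    {z : M} (hz : z ∈ e.source) : (fun p => chartField e X p k) =ᶠ[nhds (e z)] f := by
  filter_upwards [e.open_target.mem_nhds (e.map_source hz)] with p hp
  have hw := e.map_target hp
  rw [← e.right_inv hp, chartField_apply he X hw, h _ hw]

variable [IsManifold (𝓡 (n + n)) ∞ M]

theorem differentiableAt_chartField (he : e ∈ IsManifold.maximalAtlas (𝓡 (n + n)) ∞ M)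
    (X : VField n M) {p : EuclideanSpace ℝ (Fin (n + n))} (hp : p ∈ e.target) :
    DifferentiableAt ℝ (chartField e X) p := by
  have hinv := isInvertible_mfderiv_of_mdifferentiable
    (mdifferentiable_of_mem_maximalAtlas (by simp) he).symm hp
  have hpull := ContMDiffAt.mpullback_vectorField_preimage (X.contMDiff _)
    (contMDiffAt_symm_of_mem_maximalAtlas he hp) hinv (m := ∞) (by simp)
  exact (contMDiffAt_vectorSpace_iff_contDiffAt.1 hpull).differentiableAt (by simp)

theorem chartField_lieBr (he : e ∈ IsManifold.maximalAtlas (𝓡 (n + n)) ∞ M)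
    (X Y : VField n M) {p : EuclideanSpace ℝ (Fin (n + n))} (hp : p ∈ e.target) :
    chartField e (lieBr X Y) p =
      VectorField.lieBracket ℝ (chartField e X) (chartField e Y) p := by
  have : IsManifold (𝓡 (n + n)) (minSmoothness ℝ 2) M := by
    rw [minSmoothness_of_isRCLikeNormedField]
    infer_instance
  refine (VectorField.mpullback_mlieBracket X.mdifferentiableAt Y.mdifferentiableAt
    (contMDiffAt_symm_of_mem_maximalAtlas he hp)
    (by rw [minSmoothness_of_isRCLikeNormedField]; norm_cast)).trans ?_
  rw [← VectorField.mlieBracketWithin_univ, VectorField.mlieBracketWithin_eq_lieBracketWithin,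
    ← VectorField.lieBracketWithin_univ]
  rfl

theorem dcoord_lieBr (he : e ∈ IsManifold.maximalAtlas (𝓡 (n + n)) ∞ M) (X Y : VField n M)
    {z : M} (hz : z ∈ e.source) (k : Fin (n + n)) :
    dcoord e z (lieBr X Y z) k =
      fderiv ℝ (fun p => chartField e Y p k) (e z) (chartField e X (e z))
        - fderiv ℝ (fun p => chartField e X p k) (e z) (chartField e Y (e z)) := by
  have hp := e.map_source hz
  rw [← chartField_apply he (lieBr X Y) hz, chartField_lieBr he X Y hp]
  exact clm_apply_lieBracket (EuclideanSpace.proj k : EuclideanSpace ℝ (Fin (n + n)) →L[ℝ] ℝ)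
    (differentiableAt_chartField he X hp) (differentiableAt_chartField he Y hp)

end

section

variable {n : ℕ} {M : Type*} [TopologicalSpace M]
  [ChartedSpace (EuclideanSpace ℝ (Fin (n + n))) M] [IsManifold (𝓡 (n + n)) ∞ M]
  {L Γ : VForm n M} {C : VField n M}

noncomputable instance VField.instLieRing : LieRing (VField n M) where
  bracket := lieBr
  add_lie X Y Z := by
    ext1 z
    exact VectorField.mlieBracket_add_left X.mdifferentiableAt Y.mdifferentiableAt
  lie_add X Y Z := by
    ext1 z
    exact VectorField.mlieBracket_add_right Y.mdifferentiableAt Z.mdifferentiableAt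
  lie_self X := by
    ext1 z
    exact congrFun VectorField.mlieBracket_self z
  leibniz_lie X Y Z := by
    have : IsManifold (𝓡 (n + n)) (minSmoothness ℝ 3) M := by
      rw [minSmoothness_of_isRCLikeNormedField]
      infer_instance
    have hle : minSmoothness ℝ 2 ≤ ∞ := by
      rw [minSmoothness_of_isRCLikeNormedField]
      norm_cast
    ext1 z
    exact VectorField.leibniz_identity_mlieBracket_apply ((X.contMDiff z).of_le hle)
      ((Y.contMDiff z).of_le hle) ((Z.contMDiff z).of_le hle)

instance VField.instIsAddTorsionFree : IsAddTorsionFree (VField n M) :=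
  .of_isTorsionFree ℝ _

theorem VField.lie_def (X Y : VField n M) : ⁅X, Y⁆ = lieBr X Y := rfl

/-- The action of a vector `1`-form on vector fields, as an additive map. -/
noncomputable def VForm.toAddMonoidHom (K : VForm n M) : VField n M →+ VField n M where
  toFun := K.app
  map_zero' := by
    ext1 z
    exact map_zero (K z)
  map_add' X Y := by
    ext1 z
    exact map_add (K z) (X z) (Y z)

theorem VForm.app_sub (K : VForm n M) (X Y : VField n M) : K.app (X - Y) = K.app X - K.app Y :=
  map_sub K.toAddMonoidHom X Y

theorem VForm.app_neg (K : VForm n M) (X : VField n M) : K.app (-X) = -K.app X :=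
  map_neg K.toAddMonoidHom X

theorem torsion_eq_zero_iff {X Y : VField n M} :
    torsion L Γ X Y = 0 ↔ fnFormForm L Γ X Y = 0 :=
  smul_eq_zero_iff_right (by norm_num)

theorem IsConservative.fnFormForm_eq_zero (h : IsConservative L C Γ)
    (hLL : ∀ X Y : VField n M, fnFormForm L L X Y = 0) (X Y : VField n M) :
    fnFormForm L Γ X Y = 0 := by
  obtain ⟨G, -, hG⟩ := h
  have hΓ : Γ.app = endoElemBracket L.app G := funext hG
  change endoEndoBracket L.app Γ.app X Y = 0
  rw [hΓ]
  exact endoEndoBracket_endoElemBracket_eq_zero (L := L.toAddMonoidHom) hLL G X Y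

theorem IsNaturalChart.apply_eq_iff
    {e : OpenPartialHomeomorph M (EuclideanSpace ℝ (Fin (n + n)))} (he : IsNaturalChart L C e)
    {z : M} (hz : z ∈ e.source) {v u : TangentSpace (𝓡 (n + n)) z} :
    L z v = u ↔ (∀ i, dcoord e z u (Fin.castAdd n i) = 0) ∧
      ∀ i, dcoord e z u (Fin.natAdd n i) = dcoord e z v (Fin.castAdd n i) := by
  refine ⟨?_, fun ⟨hx, hy⟩ => eq_of_dcoord_eq he.mem_atlas hz fun k => ?_⟩
  · rintro rfl
    exact ⟨he.L_x z hz v, he.L_y z hz v⟩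
  · induction k using Fin.addCases with
    | left i => rw [he.L_x z hz, hx]
    | right i => rw [he.L_y z hz, hy]

namespace IsLStructure

theorem app_app (hL : IsLStructure L C) (X : VField n M) : L.app (L.app X) = 0 := by
  ext1 z
  have h : L z (X z) ∈ LinearMap.range (L z).toLinearMap := ⟨X z, rfl⟩
  rwa [hL.range_eq_ker z] at h

-- In a natural chart `V` has no `x`-components and the `x`-components of `S` are the `yⁱ`, so the
-- `x`-components of `[V, S]` are the derivatives `V yⁱ`, which are the `y`-components of `V`.
theorem app_lieBr_semispray (hL : IsLStructure L C) {V S : VField n M} (hV : L.app V = 0)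
    (hS : IsLSemispray L C S) : L.app (lieBr V S) = V := by
  ext1 z
  obtain ⟨e, hz, he⟩ := hL.natural_chart z
  have hVx : ∀ w ∈ e.source, ∀ i : Fin n, dcoord e w (V w) (Fin.castAdd n i) = 0 := by
    intro w hw i
    have hLV : L w (V w) = 0 := congrArg (fun X : VField n M => X w) hV
    rw [← ((he.apply_eq_iff hw).1 hLV).2 i]
    exact congrArg (fun u : EuclideanSpace ℝ (Fin (n + n)) => u _) (map_zero _)
  have hSx : ∀ w ∈ e.source, ∀ i : Fin n,
      dcoord e w (S w) (Fin.castAdd n i) = e w (Fin.natAdd n i) := by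
    intro w hw i
    have hLS : L w (S w) = C w := congrArg (fun X : VField n M => X w) hS
    rw [← ((he.apply_eq_iff hw).1 hLS).2 i, he.C_y w hw]
  refine (he.apply_eq_iff hz).2 ⟨hVx z hz, fun i => ?_⟩
  have hV0 : (fun p => chartField e V p (Fin.castAdd n i)) =ᶠ[nhds (e z)] fun _ => 0 :=
    chartField_eventuallyEq he.mem_atlas (fun w hw => hVx w hw i) hz
  have hSy : (fun p => chartField e S p (Fin.castAdd n i)) =ᶠ[nhds (e z)]
      (EuclideanSpace.proj (Fin.natAdd n i) : EuclideanSpace ℝ (Fin (n + n)) →L[ℝ] ℝ) :=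
    chartField_eventuallyEq he.mem_atlas (fun w hw => hSx w hw i) hz
  rw [dcoord_lieBr he.mem_atlas V S hz, hV0.fderiv_eq, hSy.fderiv_eq,
    ContinuousLinearMap.fderiv, fderiv_const_apply, zero_apply, sub_zero]
  exact (chartField_apply he.mem_atlas V hz _).symm

-- In a natural chart, swapping the `x`- and `y`-coordinates defines the linear vector field
-- `yⁱ ∂/∂xⁱ + xⁱ ∂/∂yⁱ`, which `L` maps to `yⁱ ∂/∂yⁱ`.
theorem exists_local_semispray (hL : IsLStructure L C) (z : M) :
    ∃ S : ∀ w : M, TangentSpace (𝓡 (n + n)) w,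
      ContMDiffAt (𝓡 (n + n)) (𝓡 (n + n)).tangent ∞
        (fun w => (⟨w, S w⟩ : TangentBundle (𝓡 (n + n)) M)) z ∧
      ∀ᶠ w in nhds z, L w (S w) = C w := by
  obtain ⟨e, hz, he⟩ := hL.natural_chart z
  have hinv (w : M) (hw : w ∈ e.source) : (mfderiv (𝓡 (n + n)) (𝓡 (n + n)) e w).IsInvertible :=
    isInvertible_mfderiv_of_mdifferentiable
      (mdifferentiable_of_mem_maximalAtlas (by simp) he.mem_atlas) hw
  let swap := LinearIsometryEquiv.piLpCongrLeft 2 ℝ ℝ (finAddFlip (m := n) (n := n))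
  refine ⟨VectorField.mpullback (𝓡 (n + n)) (𝓡 (n + n)) e (fun p => swap p), ?_, ?_⟩
  · exact ContMDiffAt.mpullback_vectorField_preimage
      (contMDiffAt_vectorSpace_iff_contDiffAt.2 swap.contDiff.contDiffAt)
      (contMDiffAt_of_mem_maximalAtlas he.mem_atlas hz) (hinv z hz) (m := ∞) (n := ∞)
      (by simp)
  · filter_upwards [e.open_source.mem_nhds hz] with w hw
    refine (he.apply_eq_iff hw).2 ⟨he.C_x w hw, fun i => ?_⟩
    have hswap : dcoord e w (VectorField.mpullback (𝓡 (n + n)) (𝓡 (n + n)) e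
        (fun p => swap p) w) (Fin.castAdd n i) = swap (e w) (Fin.castAdd n i) :=
      congrArg (fun v : EuclideanSpace ℝ (Fin (n + n)) => v _)
        ((hinv w hw).self_apply_inverse (swap (e w)))
    rw [hswap, he.C_y w hw, ← finAddFlip_apply_castAdd]
    rfl

end IsLStructure

namespace IsLConnection

theorem apply_of_apply_eq_zero (hL : IsLStructure L C) (hΓ : IsLConnection L Γ) {z : M}
    {v : TangentSpace (𝓡 (n + n)) z} (hv : L z v = 0) : Γ z v = -v := by
  have hker : v ∈ LinearMap.ker (L z).toLinearMap := hv
  rw [← hL.range_eq_ker z] at hker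
  obtain ⟨u, rfl⟩ := hker
  exact DFunLike.congr_fun (hΓ.right z) u

theorem apply_apply (hL : IsLStructure L C) (hΓ : IsLConnection L Γ) (z : M)
    (v : TangentSpace (𝓡 (n + n)) z) : Γ z (Γ z v) = v := by
  have hLΓ : L z (Γ z v) = L z v := DFunLike.congr_fun (hΓ.left z) v
  have h := hΓ.apply_of_apply_eq_zero hL (v := Γ z v - v) (by rw [map_sub, hLΓ, sub_self])
  rwa [map_sub, neg_sub, sub_left_inj] at h

theorem eq_of_apply_eq_self (hL : IsLStructure L C) (hΓ : IsLConnection L Γ) {z : M}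
    {v w : TangentSpace (𝓡 (n + n)) z} (hv : Γ z v = v) (hw : Γ z w = w)
    (h : L z v = L z w) : v = w := by
  have : IsAddTorsionFree (TangentSpace (𝓡 (n + n)) z) := .of_isTorsionFree ℝ _
  have hneg := hΓ.apply_of_apply_eq_zero hL (v := v - w) (by rw [map_sub, h, sub_self])
  rw [map_sub, hv, hw] at hneg
  exact sub_eq_zero.1 (self_eq_neg.1 hneg)

theorem app_left (hΓ : IsLConnection L Γ) (X : VField n M) :
    L.app (Γ.app X) = L.app X := by
  ext1 z
  exact DFunLike.congr_fun (hΓ.left z) (X z)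

theorem app_right (hΓ : IsLConnection L Γ) (X : VField n M) :
    Γ.app (L.app X) = -L.app X := by
  ext1 z
  exact DFunLike.congr_fun (hΓ.right z) (X z)

theorem app_of_app_eq_zero (hL : IsLStructure L C) (hΓ : IsLConnection L Γ) {X : VField n M}
    (hX : L.app X = 0) : Γ.app X = -X := by
  ext1 z
  exact hΓ.apply_of_apply_eq_zero hL (congrArg (fun Z : VField n M => Z z) hX)

theorem eq_of_app_eq_self (hL : IsLStructure L C) (hΓ : IsLConnection L Γ) {X Y : VField n M}
    (hX : Γ.app X = X) (hY : Γ.app Y = Y) (h : L.app X = L.app Y) : X = Y := by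
  ext1 z
  exact hΓ.eq_of_apply_eq_self hL (congrArg (fun Z : VField n M => Z z) hX)
    (congrArg (fun Z : VField n M => Z z) hY) (congrArg (fun Z : VField n M => Z z) h)

-- `½ (1 + Γ)` projects any semispray onto a horizontal one.
theorem exists_local_horizontal_semispray (hL : IsLStructure L C) (hΓ : IsLConnection L Γ)
    (z : M) : ∃ H : ∀ w : M, TangentSpace (𝓡 (n + n)) w,
      ContMDiffAt (𝓡 (n + n)) (𝓡 (n + n)).tangent ∞
        (fun w => (⟨w, H w⟩ : TangentBundle (𝓡 (n + n)) M)) z ∧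
      ∀ᶠ w in nhds z, L w (H w) = C w ∧ Γ w (H w) = H w := by
  obtain ⟨S, hS, hLS⟩ := hL.exists_local_semispray z
  refine ⟨fun w => (1 / 2 : ℝ) • (S w + Γ w (S w)),
    (hS.add_section ((Γ.contMDiff z).clm_bundle_apply hS)).const_smul_section, ?_⟩
  filter_upwards [hLS] with w hw
  have hLΓ : L w (Γ w (S w)) = L w (S w) := DFunLike.congr_fun (hΓ.left w) (S w)
  constructor
  · rw [map_smul, map_add, hLΓ, hw, ← two_smul ℝ (C w), smul_smul]
    norm_num
  · rw [map_smul, map_add, hΓ.apply_apply hL, add_comm (Γ w (S w)) (S w)]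

theorem exists_horizontal_semispray (hL : IsLStructure L C) (hΓ : IsLConnection L Γ) :
    ∃ G : VField n M, IsLSemispray L C G ∧ Γ.app G = G := by
  obtain ⟨G, hG⟩ := exists_contMDiffSection_of_local_of_unique
    (I := 𝓡 (n + n)) (F := EuclideanSpace ℝ (Fin (n + n))) (n := ∞)
    (P := fun z (v : TangentSpace (𝓡 (n + n)) z) => L z v = C z ∧ Γ z v = v)
    (fun z v w hv hw => hΓ.eq_of_apply_eq_self hL hv.2 hw.2 (hv.1.trans hw.1.symm))
    (hΓ.exists_local_horizontal_semispray hL)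
  refine ⟨G, ?_, ?_⟩
  · ext1 z
    exact (hG z).1
  · ext1 z
    exact (hG z).2

theorem isLSpray_of_app_eq_self (hL : IsLStructure L C) (hΓ : IsLConnection L Γ)
    (hΓC : IsHomogeneousOne C Γ) {G : VField n M} (hG : IsLSemispray L C G)
    (hΓG : Γ.app G = G) : IsLSpray L C G := by
  refine ⟨hG, hΓ.eq_of_app_eq_self hL ?_ hΓG ?_⟩
  · have h := hΓC G
    rw [fnFieldForm, hΓG, sub_eq_zero] at h
    exact h.symm
  · have hLC : L.app C = 0 := by rw [← hG, hL.app_app]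
    rw [hL.app_lieBr_semispray hLC hG, hG]

theorem torsion_horizontal_semispray (hL : IsLStructure L C) (hΓ : IsLConnection L Γ)
    (hΓC : IsHomogeneousOne C Γ) {G : VField n M} (hG : IsLSemispray L C G)
    (hΓG : Γ.app G = G) (X : VField n M) : torsion L Γ X G = fnFormField L G X - Γ.app X := by
  have hLG : L.app G = C := hG
  have hcomm : ⁅Γ.app X, C⁆ = Γ.app ⁅X, C⁆ := by
    rw [← lie_skew (Γ.app X) C, ← lie_skew X C, VForm.app_neg, neg_inj]
    exact sub_eq_zero.1 (hΓC X)
  have hvert : L.app ⁅Γ.app X, G⁆ = Γ.app X - X + L.app ⁅X, G⁆ := by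
    have h := hL.app_lieBr_semispray (V := Γ.app X - X)
      (by rw [VForm.app_sub, hΓ.app_left, sub_self]) hG
    rwa [← VField.lie_def, sub_lie, VForm.app_sub, sub_eq_iff_eq_add] at h
  have hhor : Γ.app ⁅L.app X, G⁆ = Γ.app X + X - ⁅L.app X, G⁆ := by
    have h := hΓ.app_of_app_eq_zero hL (X := ⁅L.app X, G⁆ - X) (by
      rw [VForm.app_sub, VField.lie_def, hL.app_lieBr_semispray (hL.app_app X) hG, sub_self])
    rw [VForm.app_sub, neg_sub, sub_eq_iff_eq_add] at h
    rw [h]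
    abel
  have htwice : fnFormForm L Γ X G = (2 : ℝ) • (fnFormField L G X - Γ.app X) := by
    simp only [fnFormForm, fnFormField, ← VField.lie_def, hΓG, hLG, hΓ.app_left, hΓ.app_right,
      hcomm, hvert, hhor, two_smul]
    abel
  rw [torsion, htwice, smul_smul]
  norm_num

theorem isConservative_of_torsion_eq_zero (hL : IsLStructure L C) (hΓ : IsLConnection L Γ)
    (hΓC : IsHomogeneousOne C Γ) (hT : ∀ X Y : VField n M, torsion L Γ X Y = 0) :
    IsConservative L C Γ := by
  obtain ⟨G, hG, hΓG⟩ := hΓ.exists_horizontal_semispray hL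
  refine ⟨G, hΓ.isLSpray_of_app_eq_self hL hΓC hG hΓG, fun X => ?_⟩
  have h := hΓ.torsion_horizontal_semispray hL hΓC hG hΓG X
  rw [hT X G] at h
  exact (sub_eq_zero.1 h.symm).symm

end IsLConnection

end

theorem theorem4_general (n : ℕ) (M : Type*) [TopologicalSpace M]
    [ChartedSpace (EuclideanSpace ℝ (Fin (n + n))) M] [IsManifold (𝓡 (n + n)) ∞ M]
    (L : VForm n M) (C : VField n M) (hL : IsLStructure L C)
    (Γ : VForm n M) (hΓ : IsLConnection L Γ) (hΓC : IsHomogeneousOne C Γ) :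
    (IsConservative L C Γ ↔ ∀ X Y : VField n M, fnFormForm L Γ X Y = 0) ∧
    ((∀ X Y : VField n M, fnFormForm L Γ X Y = 0) ↔
      ∀ X Y : VField n M, torsion L Γ X Y = 0) := by
  refine ⟨⟨fun h => h.fnFormForm_eq_zero hL.nijenhuis, fun h => ?_⟩,
    forall₂_congr fun X Y => torsion_eq_zero_iff.symm⟩
  exact hΓ.isConservative_of_torsion_eq_zero hL hΓC fun X Y => torsion_eq_zero_iff.2 (h X Y)

theorem theorem4 (n : ℕ) (hn : 1 ≤ n) (M : Type*) [TopologicalSpace M] [T2Space M]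
    [ParacompactSpace M] [ChartedSpace (EuclideanSpace ℝ (Fin (n + n))) M]
    [IsManifold (𝓡 (n + n)) ∞ M] (L : VForm n M) (C : VField n M) (hL : IsLStructure L C)
    (Γ : VForm n M) (hΓ : IsLConnection L Γ) (hΓC : IsHomogeneousOne C Γ) :
    (IsConservative L C Γ ↔ ∀ X Y : VField n M, fnFormForm L Γ X Y = 0) ∧
    ((∀ X Y : VField n M, fnFormForm L Γ X Y = 0) ↔
      ∀ X Y : VField n M, torsion L Γ X Y = 0) :=
  theorem4_general n M L C hL Γ hΓ hΓC
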